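/- For a positive integer $n$, let $\mathrm{PF}(n)$ be the set of parking functions of length $n$, i.e. sequences $\pi=(\pi_1,\ldots,\pi_n)$ of positive integers whose weakly increasing rearrangement $b_1\le\cdots\le b_n$ satisfies $b_j\le j$ for all $j$. For $\pi\in\mathrm{PF}(n)$ put $$\mathrm{cosum}(\pi)=\binom{n+1}{2}-\sum_{i=1}^n\pi_i,\qquad \mathrm{exced}(\pi)=|\{i\in\{1,\ldots,n\}:\pi_i>i\}|,$$ and define the polynomial $$\widetilde I_n(q,t)=\sum_{\pi\in\mathrm{PF}(n)}q^{\mathrm{cosum}(\pi)}t^{\mathrm{exced}(\pi)}\in\mathbb Z[q,t].$$ For a permutation $w\in\mathfrak S_n$, let $\mathrm{des}_1(w)$ be the number of big descents of $w$, i.e. of indices $i\in\{1,\ldots,n-1\}$ with $w(i)>w(i+1)+1$, and let $\mathrm{Alt}_n$ be the set of up-down alternating permutations $w\in\mathfrak S_n$, i.e. those with $w(1)<w(2)>w(3)<\cdots$. Then for every $n\ge 2$, $$\widetilde I_n(-1,t)=\sum_{w\in\mathrm{Alt}_n}t^{\mathrm{des}_1(w^{-1})+1}\quad\text{in }\mathbb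 Z[t].$$ -/

import Mathlib

open Polynomial

/-- A parking function of length `n`: a sequence of positive integers whose weakly increasing
rearrangement `b` satisfies `b_j ≤ j` for all `j ∈ {1, …, n}`. Positions are indexed by `Fin n`, so
the position `j : Fin n` is the `(j + 1)`-st one; `π ∘ Tuple.sort π` is the weakly increasing
rearrangement of `π`. -/
def IsParkingFunction {n : ℕ} (π : Fin n → ℕ) : Prop :=
  (∀ i, 1 ≤ π i) ∧ ∀ j : Fin n, π (Tuple.sort π j) ≤ (j : ℕ) + 1

instance {n : ℕ} (π : Fin n → ℕ) : Decidable (IsParkingFunction π) := by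
  unfold IsParkingFunction; infer_instance

/-- The finite set of all parking functions of length `n` (see `mem_parkingFunctions`). -/
def parkingFunctions (n : ℕ) : Finset (Fin n → ℕ) :=
  (Fintype.piFinset fun _ : Fin n => Finset.Icc 1 n).filter fun π => IsParkingFunction π

theorem mem_parkingFunctions {n : ℕ} (π : Fin n → ℕ) :
    π ∈ parkingFunctions n ↔ IsParkingFunction π := by
  simp only [parkingFunctions, Finset.mem_filter, Fintype.mem_piFinset, Finset.mem_Icc,
    and_iff_right_iff_imp]
  intro h i
  refine ⟨h.1 i, ?_⟩
  have h2 := h.2 ((Tuple.sort π).symm i)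
  have h3 := ((Tuple.sort π).symm i).isLt
  simp only [Equiv.apply_symm_apply] at h2
  omega

/-- `cosum π = binom(n+1, 2) - ∑ π_i`. For parking functions the subtraction does not truncate, see
`cosum_add_sum`. -/
def cosum {n : ℕ} (π : Fin n → ℕ) : ℕ := (n + 1).choose 2 - ∑ i, π i

theorem cosum_add_sum {n : ℕ} (π : Fin n → ℕ) (h : IsParkingFunction π) :
    cosum π + ∑ i, π i = (n + 1).choose 2 := by
  have h1 : ∑ i, π i ≤ ∑ j : Fin n, ((j : ℕ) + 1) := by
    rw [← Equiv.sum_comp (Tuple.sort π) π]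
    exact Finset.sum_le_sum fun j _ => h.2 j
  have h2 : ∑ j : Fin n, ((j : ℕ) + 1) = (n + 1).choose 2 := by
    rw [Fin.sum_univ_eq_sum_range (fun j => j + 1) n, Nat.choose_two_right, ← Finset.sum_range_id,
      Finset.sum_range_succ', add_zero]
  unfold cosum
  omega

/-- The number of strict excedances of `π`, i.e. of positions `i ∈ {1, …, n}` with `π_i > i`. -/
def exced {n : ℕ} (π : Fin n → ℕ) : ℕ :=
  (Finset.univ.filter fun i : Fin n => (i : ℕ) + 1 < π i).card

/-- The two-variable polynomial `Ĩ_n(q, t) = ∑_{π ∈ PF(n)} q^{cosum π} t^{exced π}`, as a polynomial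
in the outer variable `q` whose coefficients are polynomials in `t`. -/
noncomputable def parkingEnumerator (n : ℕ) : ℤ[X][X] :=
  ∑ π ∈ parkingFunctions n, X ^ cosum π * C (X ^ exced π)

/-- The number of big descents of `w`: indices `i ∈ {1, …, n-1}` with `w(i) > w(i+1) + 1`. -/
def bigDes {n : ℕ} (w : Equiv.Perm (Fin n)) : ℕ :=
  (Finset.univ.filter fun i : Fin n =>
    ∃ h : (i : ℕ) + 1 < n, (w ⟨(i : ℕ) + 1, h⟩ : ℕ) + 1 < (w i : ℕ)).card

/-- `w` is up-down alternating: `w_1 < w_2 > w_3 < ⋯`. As positions start from `0` here, the ascents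
are at the even positions. -/
def IsUpDown {n : ℕ} (w : Equiv.Perm (Fin n)) : Prop :=
  ∀ (i : Fin n) (h : (i : ℕ) + 1 < n),
    (Even (i : ℕ) → w i < w ⟨(i : ℕ) + 1, h⟩) ∧ (Odd (i : ℕ) → w ⟨(i : ℕ) + 1, h⟩ < w i)

instance {n : ℕ} (w : Equiv.Perm (Fin n)) : Decidable (IsUpDown w) := by
  unfold IsUpDown; infer_instance

/-- The up-down alternating permutations in the symmetric group on `n` letters. -/
def alternatingPerms (n : ℕ) : Finset (Equiv.Perm (Fin n)) :=
  Finset.univ.filter fun w => IsUpDown w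

/-!
Polynomials in `t` of degree at most `n` are separated by the functionals `t ^ k ↦ (x + k).choose n`
for `x = 0, 1, 2, …`. Both sides of the identity have the same value under each of them: the entry
at `x` of the `n`-th power of a transfer operator applied to the indicator function of `x`.

For parking functions, `(-1) ^ cosum π` is a product of signs over the partial counts
`#{i | π i ≤ k}`, and the binomial coefficient `(x + exced π).choose n` counts the `n`-element sets
of slots in `{0, …, x + n - 1}` that avoid `x + i` for every non-excedance `i`. Moving the letters
of `π` to the chosen slots turns the weighted count into one of fillings built one value at a time,
where a step depends only on the number of slots still unassigned.

For permutations, standardization of words turns the sum of `(x + 1 + bigDes w⁻¹).choose n` over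
alternating `w` into the number of alternating words of length `n` on `x + 1` letters. Reversing the
alphabet at every other position makes these the words whose adjacent letters have a sum less than
`x`, and finite differences conjugate the transfer operator to the transfer matrix of such words.
-/

section

open Finset fwdDiff

/-- The linear functional `X ^ k ↦ (x + k).choose n` on polynomials. For varying `x`, these
functionals separate the polynomials of degree at most `n`. -/
noncomputable def binomialFunctional (R : Type*) [CommRing R] (n x : ℕ) : R[X] →ₗ[R] R :=
  lsum fun k => ((x + k).choose n : R) • LinearMap.id

theorem binomialFunctional_X_pow {R : Type*} [CommRing R] (n x k : ℕ) :
    binomialFunctional R n x (X ^ k) = (x + k).choose n := by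
  simp [binomialFunctional, ← monomial_one_right_eq_X_pow, lsum_apply, sum_monomial_index]

theorem binomialFunctional_sub_natDegree {R : Type*} [CommRing R] {n : ℕ} {p : R[X]}
    (hp : p.natDegree ≤ n) : binomialFunctional R n (n - p.natDegree) p = p.leadingCoeff := by
  have hlt : ∀ k ∈ range p.natDegree, (n - p.natDegree + k).choose n = 0 := fun k hk =>
    Nat.choose_eq_zero_of_lt (by have := mem_range.1 hk; omega)
  rw [binomialFunctional, lsum_apply, sum_over_range _ (by simp), sum_range_succ,
    sum_eq_zero fun k hk => by simp [hlt k hk]]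
  simp [Nat.sub_add_cancel hp]

theorem eq_of_forall_binomialFunctional_eq {R : Type*} [CommRing R] {n : ℕ} {p q : R[X]}
    (hp : p.natDegree ≤ n) (hq : q.natDegree ≤ n)
    (h : ∀ x, binomialFunctional R n x p = binomialFunctional R n x q) : p = q := by
  rw [← sub_eq_zero, ← leadingCoeff_eq_zero,
    ← binomialFunctional_sub_natDegree ((natDegree_sub_le p q).trans (max_le hp hq)), map_sub, h,
    sub_self]

/-! ### Parking functions as fillings -/

theorem isParkingFunction_iff_le_card {n : ℕ} (π : Fin n → ℕ) : IsParkingFunction π ↔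
    (∀ i, 1 ≤ π i) ∧ ∀ k < n, k + 1 ≤ #{i | π i ≤ k + 1} := by
  refine and_congr_right fun _ => ?_
  have hsort (k : ℕ) (hk : k < n) :
      π (Tuple.sort π ⟨k, hk⟩) ≤ k + 1 ↔ k + 1 ≤ #{i | π i ≤ k + 1} := by
    have hcard : #{i | (π ∘ Tuple.sort π) i ≤ k + 1} = #{i | π i ≤ k + 1} :=
      card_equiv (Tuple.sort π) (by simp)
    rw [← hcard, Nat.succ_le_iff]
    exact (Tuple.lt_card_le_iff_apply_le_of_monotone (j := ⟨k, hk⟩) (a := k + 1)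
      (Tuple.monotone_sort π)).symm
  exact ⟨fun h k hk => (hsort k hk).1 (h ⟨k, hk⟩), fun h j => (hsort j j.2).2 (h j j.2)⟩

theorem sum_card_le_succ_add_sum {n : ℕ} {π : Fin n → ℕ} (hpos : ∀ i, 1 ≤ π i)
    (hle : ∀ i, π i ≤ n) :
    ∑ k ∈ range n, #{i | π i ≤ k + 1} + ∑ i, π i = n * (n + 1) := by
  have hIco (i : Fin n) : {k ∈ range n | π i ≤ k + 1} = Ico (π i - 1) n := by
    ext k
    simp only [mem_filter, mem_range, mem_Ico]
    omega
  simp only [card_filter]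
  rw [sum_comm, ← sum_add_distrib, sum_congr rfl (g := fun _ => n + 1)]
  · simp
  · intro i _
    rw [← card_filter, hIco, Nat.card_Ico]
    have := hpos i
    have := hle i
    omega

theorem cosum_eq_sum_card_sub {n : ℕ} {π : Fin n → ℕ} (h : IsParkingFunction π) :
    cosum π = ∑ k ∈ range n, (#{i | π i ≤ k + 1} - (k + 1)) := by
  have hle (i : Fin n) : π i ≤ n := by
    have := mem_filter.1 ((mem_parkingFunctions π).2 h)
    exact (mem_Icc.1 (Fintype.mem_piFinset.1 this.1 i)).2
  have hgauss : ∑ k ∈ range n, (k + 1) = (n + 1).choose 2 := by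
    rw [Nat.choose_two_right, ← sum_range_id, sum_range_succ', add_zero]
  have hchoose : (n + 1).choose 2 * 2 = n * (n + 1) := by
    rw [Nat.choose_two_right, ← sum_range_id, sum_range_id_mul_two, Nat.add_sub_cancel, mul_comm]
  have hsub : ∑ k ∈ range n, (#{i | π i ≤ k + 1} - (k + 1)) + ∑ k ∈ range n, (k + 1) =
      ∑ k ∈ range n, #{i | π i ≤ k + 1} := by
    rw [← sum_add_distrib]
    exact sum_congr rfl fun k hk => Nat.sub_add_cancel
      (((isParkingFunction_iff_le_card π).1 h).2 k (mem_range.1 hk))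
  have := sum_card_le_succ_add_sum h.1 hle
  have := cosum_add_sum π h
  omega

/-- The sign `(-1) ^ (N - k)` of the excess of `N` over `k`, and zero if `N < k`. -/
def excessSign (k N : ℕ) : ℤ := if k ≤ N then (-1) ^ (N - k) else 0

theorem prod_excessSign_eq {n : ℕ} {π : Fin n → ℕ} (hpos : ∀ i, 1 ≤ π i) :
    ∏ k ∈ range n, excessSign (k + 1) #{i | π i ≤ k + 1} =
      if IsParkingFunction π then (-1) ^ cosum π else 0 := by
  split_ifs with hπ
  · rw [cosum_eq_sum_card_sub hπ, ← prod_pow_eq_pow_sum]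
    exact prod_congr rfl fun k hk =>
      if_pos (((isParkingFunction_iff_le_card π).1 hπ).2 k (mem_range.1 hk))
  · rw [isParkingFunction_iff_le_card, not_and] at hπ
    obtain ⟨k, hk, hlt⟩ : ∃ k < n, ¬ k + 1 ≤ #{i | π i ≤ k + 1} := by
      simpa only [not_forall, exists_prop] using hπ hpos
    exact prod_eq_zero (mem_range.2 hk) (if_neg hlt)

/-- The functions `φ` on `{0, …, x + v - 1}` with values in `{0, …, v}` and `e < x + φ e` for
all `e`. The value `v` stands for an element that has not been assigned a value yet. -/
def partialFillings (x v : ℕ) : Finset (Fin (x + v) → ℕ) :=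
  Fintype.piFinset fun e => Icc ((e : ℕ) + 1 - x) v

theorem mem_partialFillings {x v : ℕ} {φ : Fin (x + v) → ℕ} :
    φ ∈ partialFillings x v ↔ ∀ e : Fin (x + v), (e : ℕ) + 1 - x ≤ φ e ∧ φ e ≤ v := by
  simp [partialFillings]

theorem mem_partialFillings_succ {x v : ℕ} {ψ : Fin (x + v + 1) → ℕ} :
    ψ ∈ partialFillings x (v + 1) ↔
      (∀ e : Fin (x + v), (e : ℕ) + 1 - x ≤ ψ e.castSucc ∧ ψ e.castSucc ≤ v + 1) ∧
        ψ (Fin.last (x + v)) = v + 1 := by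
  rw [mem_partialFillings]
  change (∀ e : Fin (x + v + 1), (e : ℕ) + 1 - x ≤ ψ e ∧ ψ e ≤ v + 1) ↔ _
  rw [Fin.forall_fin_succ']
  simp only [Fin.val_castSucc, Fin.val_last]
  refine and_congr Iff.rfl ?_
  omega

/-- The product of the signs of the excesses of the numbers `#{e | φ e ≤ k}` over `k + 1`, for
`k < v`. For the filling of a word, this is `(-1) ^ cosum` on parking functions and zero on all
other words. -/
def fillingSign {m : ℕ} (v : ℕ) (φ : Fin m → ℕ) : ℤ :=
  ∏ k ∈ range v, excessSign (k + 1) #{e | φ e < k + 1}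

/-- Extend a partial filling to one more value, leaving precisely the elements of `B` and the new
element unassigned. -/
def extendFilling {m : ℕ} (v : ℕ) (φ : Fin m → ℕ) (B : Finset (Fin m)) : Fin (m + 1) → ℕ :=
  Fin.snoc (α := fun _ => ℕ) (B.piecewise (fun _ => v + 1) φ) (v + 1)

theorem card_filter_extendFilling {m : ℕ} (v : ℕ) (φ : Fin m → ℕ) (B : Finset (Fin m))
    (p : ℕ → Prop) [DecidablePred p] :
    #{e | p (extendFilling v φ B e)} =
      #{e | p (B.piecewise (fun _ => v + 1) φ e)} + if p (v + 1) then 1 else 0 := by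
  rw [card_filter, Fin.sum_univ_castSucc, card_filter]
  simp only [extendFilling, Fin.snoc_castSucc, Fin.snoc_last]

theorem card_extendFilling_eq {m v : ℕ} {φ : Fin m → ℕ} (hφ : ∀ e, φ e ≤ v) (B : Finset (Fin m)) :
    #{e | extendFilling v φ B e = v + 1} = #B + 1 := by
  rw [card_filter_extendFilling v φ B (· = v + 1), if_pos rfl]
  refine congrArg (#· + 1) ?_
  ext e
  have := hφ e
  grind [piecewise]

theorem fillingSign_extendFilling {m v : ℕ} {φ : Fin m → ℕ} (hφ : ∀ e, φ e ≤ v)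
    {B : Finset (Fin m)} (hB : B ⊆ ({e | φ e = v} : Finset (Fin m))) :
    fillingSign (v + 1) (extendFilling v φ B) =
      fillingSign v φ * excessSign (v + 1) (m - #B) := by
  rw [fillingSign, prod_range_succ, fillingSign]
  congr 1
  · refine prod_congr rfl fun k hk => congrArg _ ?_
    have hk := mem_range.1 hk
    rw [card_filter_extendFilling v φ B (· < k + 1), if_neg (by omega), add_zero]
    refine congrArg card (filter_congr fun e _ => ?_)
    grind [piecewise]
  · rw [card_filter_extendFilling v φ B (· < v + 1), if_neg (lt_irrefl _), add_zero]
    have hcompl : ({e | B.piecewise (fun _ => v + 1) φ e < v + 1} : Finset (Fin m)) = Bᶜ := by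
      ext e
      have := hφ e
      grind [piecewise, mem_compl]
    rw [hcompl, card_compl, Fintype.card_fin]

theorem extendFilling_min {m v : ℕ} {ψ : Fin (m + 1) → ℕ}
    (hψ : ∀ e : Fin m, ψ e.castSucc ≤ v + 1) (hlast : ψ (Fin.last m) = v + 1) :
    extendFilling v (fun e => min (ψ e.castSucc) v) {e | ψ e.castSucc = v + 1} = ψ := by
  refine funext <| Fin.lastCases ?_ fun e => ?_
  · rw [extendFilling, Fin.snoc_last, hlast]
  · rw [extendFilling, Fin.snoc_castSucc]
    have := hψ e
    grind [piecewise]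

theorem sum_partialFillings_succ_eq_sum_powerset {M : Type*} [AddCommMonoid M] (x v : ℕ)
    (F : (Fin (x + v + 1) → ℕ) → M) :
    ∑ ψ ∈ partialFillings x (v + 1), F ψ =
      ∑ φ ∈ partialFillings x v, ∑ B ∈ powerset {e | φ e = v}, F (extendFilling v φ B) := by
  rw [sum_sigma']
  symm
  refine sum_bij' (fun p _ => extendFilling v p.1 p.2)
    (fun ψ _ => (⟨fun e : Fin (x + v) => min (ψ e.castSucc) v,
      univ.filter fun e : Fin (x + v) => ψ e.castSucc = v + 1⟩ :
      (_ : Fin (x + v) → ℕ) × Finset (Fin (x + v))))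
    (fun ⟨φ, B⟩ h => ?_) (fun ψ hψ => ?_) (fun ⟨φ, B⟩ h => ?_) (fun ψ hψ => ?_) fun _ _ => rfl
  · simp only [mem_sigma, mem_partialFillings, mem_powerset] at h
    refine mem_partialFillings_succ.2 ⟨fun e => ?_, Fin.snoc_last ..⟩
    rw [extendFilling, Fin.snoc_castSucc]
    have := h.1 e
    grind [piecewise]
  · obtain ⟨hle, -⟩ := mem_partialFillings_succ.1 hψ
    simp only [mem_sigma, mem_partialFillings, mem_powerset]
    refine ⟨fun e => ?_, fun e he => ?_⟩
    · have := hle e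
      omega
    · have := (mem_filter.1 he).2
      exact mem_filter.2 ⟨mem_univ e, by omega⟩
  · simp only [mem_sigma, mem_partialFillings, mem_powerset] at h
    simp only [extendFilling, Fin.snoc_castSucc, Sigma.mk.injEq, heq_eq_eq]
    refine ⟨funext fun e => ?_, Finset.ext fun e => ?_⟩
    · have := h.1 e
      grind [piecewise]
    · have := h.1 e
      grind [piecewise]
  · obtain ⟨hle, hlast⟩ := mem_partialFillings_succ.1 hψ
    exact extendFilling_min (fun e => (hle e).2) hlast

/-- The transfer operator of `sum_partialFillings_succ`, acting on functions of the number of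
unassigned elements: a partial filling that leaves `u` elements unassigned has `u.choose m`
extensions by one more value that leave `m + 1` elements unassigned, and each of them multiplies
`fillingSign` by `(-1) ^ (x - 1 - m)` if `m < x` and by zero otherwise. -/
def excessTransfer (x : ℕ) (g : ℕ → ℤ) (u : ℕ) : ℤ :=
  ∑ m ∈ range x, (-1) ^ (x - 1 - m) * u.choose m * g (m + 1)

theorem sum_range_choose_smul_excessSign (x v u : ℕ) (g : ℕ → ℤ) :
    ∑ m ∈ range (u + 1), u.choose m • (excessSign (v + 1) (x + v - m) * g (m + 1)) =
      excessTransfer x g u := by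
  refine sum_congr_of_eq_on_inter (fun m _ hm => ?_) (fun m _ hm => ?_) fun m _ hm => ?_
  · have := mem_range.not.1 hm
    rw [excessSign, if_neg (by omega), zero_mul, smul_zero]
  · rw [Nat.choose_eq_zero_of_lt (by simpa using hm)]
    simp
  · have := mem_range.1 hm
    rw [excessSign, if_pos (by omega), show x + v - m - (v + 1) = x - 1 - m by omega, nsmul_eq_mul]
    ring

theorem sum_partialFillings_succ (x v : ℕ) (g : ℕ → ℤ) :
    ∑ φ ∈ partialFillings x (v + 1), fillingSign (v + 1) φ * g #{e | φ e = v + 1} =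
      ∑ φ ∈ partialFillings x v, fillingSign v φ * excessTransfer x g #{e | φ e = v} := by
  refine (sum_partialFillings_succ_eq_sum_powerset x v fun φ =>
    fillingSign (v + 1) φ * g #{e | φ e = v + 1}).trans (sum_congr rfl fun φ hφ => ?_)
  have hle e : φ e ≤ v := (mem_partialFillings.1 hφ e).2
  rw [← sum_range_choose_smul_excessSign x v, ← sum_powerset_apply_card
    (fun m => excessSign (v + 1) (x + v - m) * g (m + 1)), mul_sum]
  refine sum_congr rfl fun B hB => ?_
  rw [fillingSign_extendFilling hle (mem_powerset.1 hB), card_extendFilling_eq hle, mul_assoc]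

theorem sum_partialFillings_eq_iterate_excessTransfer (x v : ℕ) (g : ℕ → ℤ) :
    ∑ φ ∈ partialFillings x v, fillingSign v φ * g #{e | φ e = v} =
      (excessTransfer x)^[v] g x := by
  induction v generalizing g with
  | zero =>
    have hzero : partialFillings x 0 = {fun _ => 0} := by
      ext φ
      simp only [mem_partialFillings, mem_singleton, funext_iff]
      exact forall_congr' fun e => by omega
    simp [hzero, fillingSign]
  | succ v ih => rw [sum_partialFillings_succ, ih, Function.iterate_succ_apply]

theorem sum_partialFillings_card_lt_eq (x n : ℕ) :
    ∑ φ ∈ partialFillings x n with #{e | φ e < n} = n, fillingSign n φ =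
      (excessTransfer x)^[n] (Pi.single x 1) x := by
  rw [← sum_partialFillings_eq_iterate_excessTransfer, sum_filter]
  refine sum_congr rfl fun φ hφ => ?_
  have hcard : #{e | φ e < n} + #{e | φ e = n} = x + n := by
    have hnot : ({e | φ e = n} : Finset (Fin (x + n))) = ({e | ¬ φ e < n} : Finset _) :=
      filter_congr fun e _ => by have := (mem_partialFillings.1 hφ e).2; omega
    rw [hnot, card_filter_add_card_filter_not, card_univ, Fintype.card_fin]
  simp only [Pi.single_apply, mul_ite, mul_one, mul_zero]
  exact if_congr (by omega) rfl rfl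

/-- The elements of `{0, …, x + n - 1}` other than the `x + i` for which the position `i` is not an
excedance of `π`. Placing the letter `π i` at the slot `x + i` gives a value allowed in
`partialFillings` exactly when this set contains `x + i`. -/
def excedanceSlots (x : ℕ) {n : ℕ} (π : Fin n → ℕ) : Finset (Fin (x + n)) :=
  {e | ∀ i, e = Fin.natAdd x i → (i : ℕ) + 1 < π i}

theorem castAdd_ne_natAdd {m n : ℕ} (a : Fin m) (i : Fin n) : Fin.castAdd n a ≠ Fin.natAdd m i :=
  Fin.ne_of_val_ne (a.2.trans_le (Nat.le_add_right m i)).ne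

theorem card_excedanceSlots (x : ℕ) {n : ℕ} (π : Fin n → ℕ) :
    #(excedanceSlots x π) = x + exced π := by
  rw [excedanceSlots, card_filter, Fin.sum_univ_add, exced, card_filter]
  simp [castAdd_ne_natAdd]

theorem exists_injective_extending_natAdd {x n : ℕ} {T : Finset (Fin (x + n))} (hT : #T = n) :
    ∃ ι : Fin n → Fin (x + n), ι.Injective ∧ (∀ e, e ∈ T ↔ ∃ i, ι i = e) ∧
      ∀ i, Fin.natAdd x i ∈ T → ι i = Fin.natAdd x i := by
  obtain ⟨g, hg⟩ := exists_equiv_extend_of_card_eq (α := Fin n) (t := T)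
    (by rw [Fintype.card_fin, hT]) (s := {i | Fin.natAdd x i ∈ T}) (f := Fin.natAdd x)
    (image_subset_iff.2 fun i hi => (mem_filter.1 hi).2) (Fin.natAdd_injective _ _).injOn
  refine ⟨fun i => g i, Subtype.val_injective.comp g.injective, fun e => ⟨fun he => ?_, ?_⟩,
    fun i hi => hg i (mem_filter.2 ⟨mem_univ i, hi⟩)⟩
  · exact ⟨g.symm ⟨e, he⟩, congrArg Subtype.val (g.apply_symm_apply _)⟩
  · rintro ⟨i, rfl⟩
    exact (g i).2

section words

variable {x n : ℕ} {T : Finset (Fin (x + n))} {ι : Fin n → Fin (x + n)} {φ : Fin (x + n) → ℕ}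

theorem fillingSign_eq_prod_comp (hinj : ι.Injective) (hφ : ∀ e, φ e < n → ∃ i, ι i = e) :
    fillingSign n φ = ∏ k ∈ range n, excessSign (k + 1) #{i | φ (ι i) + 1 ≤ k + 1} := by
  refine prod_congr rfl fun k hk => congrArg _ (Eq.symm ?_)
  have hk := mem_range.1 hk
  refine card_bij (fun i _ => ι i) (fun i hi => ?_) (fun i _ j _ h => hinj h) fun e he => ?_
  · exact mem_filter.2 ⟨mem_univ _, (mem_filter.1 hi).2⟩
  · have hlt := (mem_filter.1 he).2
    obtain ⟨i, rfl⟩ := hφ e (by omega)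
    exact ⟨i, mem_filter.2 ⟨mem_univ i, hlt⟩, rfl⟩

theorem mem_partialFillings_iff_subset_excedanceSlots
    (hι : ∀ i, Fin.natAdd x i ∈ T → ι i = Fin.natAdd x i) (hle : ∀ e, φ e ≤ n)
    (hT : ∀ e, φ e < n ↔ e ∈ T) :
    φ ∈ partialFillings x n ↔ T ⊆ excedanceSlots x fun i => φ (ι i) + 1 := by
  simp only [mem_partialFillings, hle, and_true, subset_iff, excedanceSlots, mem_filter_univ]
  refine forall_congr' <| Fin.addCases (fun a => ?_) fun i => ?_
  · simp only [castAdd_ne_natAdd, false_imp_iff, implies_true, iff_true, Fin.val_castAdd]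
    omega
  · simp only [(Fin.natAdd_injective n x).eq_iff, forall_eq', Fin.val_natAdd, add_lt_add_iff_right]
    refine ⟨fun h hi => ?_, fun h => ?_⟩
    · rw [hι i hi]
      omega
    · by_cases hi : Fin.natAdd x i ∈ T
      · have := h hi
        rw [hι i hi] at this
        omega
      · have := mt (hT (Fin.natAdd x i)).1 hi
        omega

/-- The filling of the slots in the range of `ι` by the letters of the word `π`, shifted to start
from `0`; all other slots stay unassigned, that is, have the value `n`. -/
noncomputable def wordFilling (ι : Fin n → Fin (x + n)) (π : Fin n → ℕ) : Fin (x + n) → ℕ :=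
  Function.extend ι (fun i => π i - 1) fun _ => n

theorem wordFilling_of_notMem_range {π : Fin n → ℕ} {e : Fin (x + n)} (he : ¬ ∃ i, ι i = e) :
    wordFilling ι π e = n :=
  Function.extend_apply' _ _ _ he

theorem wordFilling_comp_add_one (hinj : ι.Injective) {π : Fin n → ℕ} (hπ : ∀ i, 1 ≤ π i) :
    (fun i => wordFilling ι π (ι i) + 1) = π := by
  funext i
  rw [wordFilling, hinj.extend_apply, Nat.sub_add_cancel (hπ i)]

theorem wordFilling_add_one_comp (hinj : ι.Injective) (hφ : ∀ e, φ e ≠ n → ∃ i, ι i = e) :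
    (wordFilling ι fun i => φ (ι i) + 1) = φ := by
  funext e
  by_cases he : ∃ i, ι i = e
  · obtain ⟨i, rfl⟩ := he
    rw [wordFilling, hinj.extend_apply, Nat.add_sub_cancel]
  · rw [wordFilling_of_notMem_range he, not_imp_comm.1 (hφ e) he]

theorem wordFilling_lt (hinj : ι.Injective) {π : Fin n → ℕ} (hpos : ∀ i, 1 ≤ π i)
    (hle : ∀ i, π i ≤ n) (i : Fin n) : wordFilling ι π (ι i) < n := by
  rw [wordFilling, hinj.extend_apply]
  exact (Nat.sub_one_lt_of_le (hpos i) le_rfl).trans_le (hle i)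

theorem sum_words_subset_excedanceSlots (hT : #T = n) :
    ∑ π ∈ (Fintype.piFinset fun _ : Fin n => Icc 1 n) with T ⊆ excedanceSlots x π,
      ∏ k ∈ range n, excessSign (k + 1) #{i | π i ≤ k + 1} =
    ∑ φ ∈ partialFillings x n with ({e | φ e < n} : Finset (Fin (x + n))) = T,
      fillingSign n φ := by
  obtain ⟨ι, hinj, hrange, hι⟩ := exists_injective_extending_natAdd hT
  have hassigned {φ : Fin (x + n) → ℕ} (hφ : ({e | φ e < n} : Finset (Fin (x + n))) = T) e :
      φ e < n ↔ e ∈ T := by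
    rw [← hφ, mem_filter_univ]
  symm
  refine sum_bij' (fun φ _ i => φ (ι i) + 1) (fun π _ => wordFilling ι π) (fun φ hφ => ?_)
    (fun π hπ => ?_) (fun φ hφ => ?_) (fun π hπ => ?_) fun φ hφ => ?_
  · obtain ⟨hφ, hT⟩ := mem_filter.1 hφ
    simp only [mem_filter, Fintype.mem_piFinset, mem_Icc]
    exact ⟨fun i => ⟨Nat.le_add_left 1 _, (hassigned hT _).2 ((hrange _).2 ⟨i, rfl⟩)⟩,
      (mem_partialFillings_iff_subset_excedanceSlots hι
        (fun e => (mem_partialFillings.1 hφ e).2) (hassigned hT)).1 hφ⟩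
  · simp only [mem_filter, Fintype.mem_piFinset, mem_Icc] at hπ
    have hpos i := (hπ.1 i).1
    have hlt := wordFilling_lt hinj hpos fun i => (hπ.1 i).2
    have hvalue e : wordFilling ι π e ≤ n ∧ (wordFilling ι π e < n ↔ e ∈ T) := by
      by_cases he : ∃ i, ι i = e
      · obtain ⟨i, rfl⟩ := he
        exact ⟨(hlt i).le, iff_of_true (hlt i) ((hrange _).2 ⟨i, rfl⟩)⟩
      · simp [wordFilling_of_notMem_range he, hrange, he]
    refine mem_filter.2 ⟨(mem_partialFillings_iff_subset_excedanceSlots hι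
      (fun e => (hvalue e).1) fun e => (hvalue e).2).2 ?_, ?_⟩
    · rw [wordFilling_comp_add_one hinj hpos]
      exact hπ.2
    · ext e
      rw [mem_filter_univ, (hvalue e).2]
  · obtain ⟨hφ, hT⟩ := mem_filter.1 hφ
    refine wordFilling_add_one_comp hinj fun e he => (hrange e).1 ?_
    exact (hassigned hT e).1 ((mem_partialFillings.1 hφ e).2.lt_of_ne he)
  · exact wordFilling_comp_add_one hinj fun i =>
      (mem_Icc.1 (Fintype.mem_piFinset.1 (mem_filter.1 hπ).1 i)).1
  · exact fillingSign_eq_prod_comp hinj fun e he =>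
      (hrange e).1 ((hassigned (mem_filter.1 hφ).2 e).1 he)

end words

theorem sum_parkingFunctions_choose (x n : ℕ) :
    ∑ π ∈ parkingFunctions n, (-1 : ℤ) ^ cosum π * (x + exced π).choose n =
      (excessTransfer x)^[n] (Pi.single x 1) x := by
  rw [← sum_partialFillings_card_lt_eq, ← sum_fiberwise_of_maps_to (f := fillingSign n)
    (t := powersetCard n univ) (g := fun φ => ({e | φ e < n} : Finset (Fin (x + n))))
    fun φ hφ => mem_powersetCard.2 ⟨subset_univ _, (mem_filter.1 hφ).2⟩]
  have hwords : ∀ T ∈ powersetCard n (univ : Finset (Fin (x + n))),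
      ∑ φ ∈ partialFillings x n with #{e | φ e < n} = n ∧
        ({e | φ e < n} : Finset (Fin (x + n))) = T, fillingSign n φ =
      ∑ π ∈ (Fintype.piFinset fun _ : Fin n => Icc 1 n) with T ⊆ excedanceSlots x π,
        if IsParkingFunction π then (-1) ^ cosum π else 0 := fun T hT => by
    have hT := (mem_powersetCard.1 hT).2
    rw [filter_congr fun φ _ => and_iff_right_of_imp fun h => by rw [h, hT],
      ← sum_words_subset_excedanceSlots hT]
    exact sum_congr rfl fun π hπ => prod_excessSign_eq fun i =>
      (mem_Icc.1 (Fintype.mem_piFinset.1 (mem_filter.1 hπ).1 i)).1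
  have hslots (π : Fin n → ℕ) : {T ∈ powersetCard n (univ : Finset (Fin (x + n))) |
      T ⊆ excedanceSlots x π} = powersetCard n (excedanceSlots x π) := by
    ext T
    simp [mem_powersetCard, and_comm]
  simp only [filter_filter]
  rw [sum_congr rfl hwords, sum_comm' (t' := Fintype.piFinset fun _ : Fin n => Icc 1 n)
    (s' := fun π => powersetCard n (excedanceSlots x π))
    fun T π => by simp only [← hslots, mem_filter]; tauto, parkingFunctions, sum_filter]
  refine sum_congr rfl fun π _ => ?_
  rw [sum_const, card_powersetCard, card_excedanceSlots]
  split_ifs <;> simp [mul_comm]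

/-! ### Zigzag words -/

theorem fwdDiff_iter_choose_of_lt {m i : ℕ} (h : m < i) :
    Δ_[1] ^[i] (fun u => u.choose m : ℕ → ℤ) = 0 := by
  obtain ⟨j, rfl⟩ := Nat.exists_eq_add_of_lt h
  have hconst : Δ_[1] ^[m] (fun u => u.choose m : ℕ → ℤ) = fun _ => 1 := by
    simpa using fwdDiff_iter_choose 0 m
  rw [show m + j + 1 = j + (1 + m) by ring, Function.iterate_add_apply, Function.iterate_add_apply,
    hconst, Function.iterate_one, fwdDiff_const]
  exact Function.iterate_fixed (fwdDiff_const 1 0) j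

theorem fwdDiff_iter_excessTransfer (x i : ℕ) (g : ℕ → ℤ) (u : ℕ) :
    Δ_[1] ^[i] (excessTransfer x g) u = ∑ m ∈ range x,
      (-1) ^ (x - 1 - m) * Δ_[1] ^[i] (fun u => u.choose m : ℕ → ℤ) u * g (m + 1) := by
  have hsum : excessTransfer x g = ∑ m ∈ range x,
      ((-1) ^ (x - 1 - m) * g (m + 1)) • (fun u => u.choose m : ℕ → ℤ) := by
    funext u
    simp only [excessTransfer, Finset.sum_apply, Pi.smul_apply, smul_eq_mul, mul_right_comm]
  simp only [hsum, fwdDiff_iter_finsetSum, fwdDiff_iter_const_smul, Finset.sum_apply, Pi.smul_apply,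
    smul_eq_mul, mul_right_comm]

theorem fwdDiff_iter_excessTransfer_self (x : ℕ) (g : ℕ → ℤ) :
    Δ_[1] ^[x] (excessTransfer x g) = 0 := by
  funext u
  rw [fwdDiff_iter_excessTransfer]
  exact sum_eq_zero fun m hm => by simp [fwdDiff_iter_choose_of_lt (mem_range.1 hm)]

theorem fwdDiff_iter_excessTransfer_symm (i j : ℕ) (g : ℕ → ℤ) :
    Δ_[1] ^[i] (excessTransfer (i + (j + 1)) g) j = Δ_[1] ^[j] g (i + 1) := by
  rw [fwdDiff_iter_excessTransfer, sum_range_add, fwdDiff_iter_eq_sum_shift]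
  rw [sum_eq_zero fun m hm => by simp [fwdDiff_iter_choose_of_lt (mem_range.1 hm)], zero_add]
  refine sum_congr rfl fun k _ => ?_
  rw [fwdDiff_iter_choose, show i + (j + 1) - 1 - (i + k) = j - k by omega]
  simp [add_right_comm]

theorem fwdDiff_iter_excessTransfer_eq_sum (i p : ℕ) (g : ℕ → ℤ) :
    Δ_[1] ^[i] (excessTransfer (i + p) g) p =
      ∑ b ∈ range p, Δ_[1] ^[b] g (i + p - b) := by
  induction p generalizing i with
  | zero => simpa using congrFun (fwdDiff_iter_excessTransfer_self i g) 0
  | succ p ih =>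
    have hstep : Δ_[1] ^[i] (excessTransfer (i + (p + 1)) g) (p + 1) =
        Δ_[1] ^[i + 1] (excessTransfer (i + 1 + p) g) p +
          Δ_[1] ^[i] (excessTransfer (i + (p + 1)) g) p := by
      rw [Function.iterate_succ_apply', fwdDiff, add_assoc i 1 p, add_comm 1 p, sub_add_cancel]
    rw [hstep, ih, fwdDiff_iter_excessTransfer_symm, sum_range_succ, add_assoc i 1 p, add_comm 1 p,
      show i + (p + 1) - p = i + 1 by omega]

theorem fwdDiff_iter_single (i p : ℕ) :
    Δ_[1] ^[i] (Pi.single (i + p) 1 : ℕ → ℤ) p = 1 := by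
  rw [fwdDiff_iter_eq_sum_shift, sum_range_succ, sum_eq_zero]
  · simp [add_comm p]
  · intro k hk
    have := mem_range.1 hk
    simp [show p + k ≠ i + p by omega]

/-- The words of length `k + 1` whose adjacent letters are related by `r`: the walks with `k` steps
in the digraph of `r`, which are counted by its transfer matrix. -/
def chainWords {α : Type*} [Fintype α] (r : α → α → Prop) [DecidableRel r] (k : ℕ) :
    Finset (Fin (k + 1) → α) :=
  {a | ∀ i : Fin k, r (a i.castSucc) (a i.succ)}

section chainWords

variable {α : Type*} [Fintype α] {r : α → α → Prop} [DecidableRel r] {k : ℕ}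

theorem mem_chainWords {a : Fin (k + 1) → α} :
    a ∈ chainWords r k ↔ ∀ i : Fin k, r (a i.castSucc) (a i.succ) := by
  simp [chainWords]

theorem cons_mem_chainWords {a : Fin (k + 1) → α} {b : α} :
    (Fin.cons b a : Fin (k + 2) → α) ∈ chainWords r (k + 1) ↔ r b (a 0) ∧ a ∈ chainWords r k := by
  simp [mem_chainWords, Fin.forall_fin_succ (n := k)]

variable [DecidableEq α] (r k)

theorem card_chainWords_succ_head (b : α) :
    #{a ∈ chainWords r (k + 1) | a 0 = b} = #{a ∈ chainWords r k | r b (a 0)} := by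
  symm
  refine card_bij (fun a _ => (Fin.cons b a : Fin (k + 2) → α)) (fun a ha => ?_)
    (fun a _ a' _ h => (Fin.cons_inj.1 h).2) fun a ha => ?_
  · simpa [cons_mem_chainWords, and_comm] using ha
  · obtain ⟨hmem, rfl⟩ := mem_filter.1 ha
    rw [← Fin.cons_self_tail a, cons_mem_chainWords] at hmem
    exact ⟨Fin.tail a, mem_filter.2 hmem.symm, Fin.cons_self_tail a⟩

theorem card_chainWords_succ_head_eq_sum (b : α) :
    #{a ∈ chainWords r (k + 1) | a 0 = b} = ∑ c with r b c, #{a ∈ chainWords r k | a 0 = c} := by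
  rw [card_chainWords_succ_head, card_eq_sum_card_fiberwise (f := fun a => a 0) (t := {c | r b c})
    fun a ha => by simpa using (mem_filter.1 ha).2]
  refine sum_congr rfl fun c hc => congrArg card ?_
  rw [filter_filter]
  refine filter_congr fun a _ => and_iff_right_of_imp ?_
  rintro rfl
  simpa using hc

end chainWords

/-- The words of length `k + 1` on the letters `0, …, x` in which adjacent letters have a sum less
than `x`. -/
def zigzagWords (x k : ℕ) : Finset (Fin (k + 1) → Fin (x + 1)) :=
  chainWords (fun a b : Fin (x + 1) => (a + b : ℕ) < x) k

theorem card_zigzagWords_head (x k : ℕ) (i : Fin (x + 1)) :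
    (#{a ∈ zigzagWords x k | a 0 = i} : ℤ) =
      Δ_[1] ^[i] ((excessTransfer x)^[k] (Pi.single x 1)) (x - i) := by
  have hi : i + (x - i) = x := Nat.add_sub_cancel' (Fin.is_le i)
  induction k generalizing i with
  | zero =>
    have hword : {a ∈ zigzagWords x 0 | a 0 = i} = {fun _ => i} := by
      ext a
      simp [zigzagWords, mem_chainWords, funext_iff, Fin.forall_fin_one]
    have hsingle := fwdDiff_iter_single i (x - i)
    rw [hi] at hsingle
    rw [hword, card_singleton, Function.iterate_zero_apply, hsingle, Nat.cast_one]
  | succ k ih =>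
    set g := (excessTransfer x)^[k] (Pi.single x 1) with hg
    have hrange : {c ∈ range (x + 1) | i + c < x} = range (x - i) := by
      ext c
      simp only [mem_filter, mem_range]
      omega
    have hfwdDiff := fwdDiff_iter_excessTransfer_eq_sum i (x - i) g
    rw [hi] at hfwdDiff
    rw [zigzagWords, card_chainWords_succ_head_eq_sum, Function.iterate_succ_apply', ← hg,
      hfwdDiff, ← hrange, sum_filter, sum_filter,
      ← Fin.sum_univ_eq_sum_range fun c => if i + c < x then Δ_[1] ^[c] g (x - c) else 0,
      Nat.cast_sum]
    refine sum_congr rfl fun c _ => ?_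
    split_ifs
    · exact ih c (Nat.add_sub_cancel' (Fin.is_le c))
    · rfl

theorem card_zigzagWords (x k : ℕ) :
    (#(zigzagWords x (k + 1)) : ℤ) = (excessTransfer x)^[k + 2] (Pi.single x 1) x := by
  have hhead : #(zigzagWords x (k + 1)) = #{a ∈ zigzagWords x (k + 2) | a 0 = 0} := by
    rw [zigzagWords, zigzagWords, card_chainWords_succ_head, filter_true_of_mem]
    intro a ha
    have := mem_chainWords.1 ha 0
    simp only [Fin.castSucc_zero] at this
    simp only [Fin.val_zero]
    omega
  rw [hhead, card_zigzagWords_head]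
  simp

/-! ### Alternating permutations -/

theorem card_filter_strictMono (n m : ℕ) : #{d : Fin n → Fin m | StrictMono d} = m.choose n := by
  let e : {d : Fin n → Fin m // StrictMono d} ≃ (Fin n ↪o Fin m) :=
    ⟨fun d => .ofStrictMono d.1 d.2, fun d => ⟨d, d.strictMono⟩, fun _ => rfl, fun _ => rfl⟩
  rw [← Fintype.card_subtype, ← Nat.card_eq_fintype_card,
    Nat.card_congr (e.trans Set.powersetCard.ofFinEmbEquiv), Set.powersetCard.card, Nat.card_fin]

/-- The number of elements of `P` before the position `j`. -/
def countBefore {N : ℕ} (P : Finset (Fin N)) (j : Fin (N + 1)) : ℕ :=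
  #{i ∈ P | i.castSucc < j}

theorem countBefore_zero {N : ℕ} (P : Finset (Fin N)) : countBefore P 0 = 0 := by
  simp [countBefore]

theorem countBefore_last {N : ℕ} (P : Finset (Fin N)) : countBefore P (Fin.last N) = #P := by
  simp [countBefore, Fin.castSucc_lt_last]

theorem countBefore_le_card {N : ℕ} (P : Finset (Fin N)) (j : Fin (N + 1)) :
    countBefore P j ≤ #P := card_filter_le _ _

theorem countBefore_succ {N : ℕ} (P : Finset (Fin N)) (i : Fin N) :
    countBefore P i.succ = countBefore P i.castSucc + if i ∈ P then 1 else 0 := by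
  rw [countBefore, countBefore, card_filter, card_filter, ← sum_ite_eq P i fun _ => 1,
    ← sum_add_distrib]
  refine sum_congr rfl fun j _ => ?_
  simp only [Fin.castSucc_lt_succ_iff, Fin.castSucc_lt_castSucc_iff]
  grind

/-- The monotone words of length `N + 1` on `m` letters in which only the adjacent letters
at the positions in `P` may be equal. -/
def weakAtWords (m : ℕ) {N : ℕ} (P : Finset (Fin N)) : Finset (Fin (N + 1) → Fin m) :=
  {c | ∀ i : Fin N, c i.castSucc < c i.succ ∨ c i.castSucc = c i.succ ∧ i ∈ P}

theorem mem_weakAtWords {m N : ℕ} {P : Finset (Fin N)} {c : Fin (N + 1) → Fin m} :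
    c ∈ weakAtWords m P ↔
      ∀ i : Fin N, c i.castSucc < c i.succ ∨ c i.castSucc = c i.succ ∧ i ∈ P := by
  simp [weakAtWords]

theorem mem_weakAtWords_iff_strictMono {m N : ℕ} {P : Finset (Fin N)} {c : Fin (N + 1) → Fin m} :
    c ∈ weakAtWords m P ↔ StrictMono fun j => (c j : ℕ) + countBefore P j := by
  rw [mem_weakAtWords, Fin.strictMono_iff_lt_succ]
  refine forall_congr' fun i => ?_
  simp only [countBefore_succ, Fin.lt_def, Fin.ext_iff]
  split_ifs with hi <;> simp only [hi, and_true, and_false, or_false] <;> omega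

theorem monotone_sub_countBefore {N : ℕ} (P : Finset (Fin N)) {d : Fin (N + 1) → ℕ}
    (hd : StrictMono d) : Monotone fun j => (d j - countBefore P j : ℤ) := by
  refine Fin.monotone_iff_le_succ.2 fun i => ?_
  have := hd (Fin.castSucc_lt_succ (i := i))
  simp only [countBefore_succ]
  split_ifs <;> push_cast <;> omega

theorem card_weakAtWords (m : ℕ) {N : ℕ} (P : Finset (Fin N)) :
    #(weakAtWords m P) = (m + #P).choose (N + 1) := by
  rw [← card_filter_strictMono]
  refine card_bij
    (fun c _ j => ⟨c j + countBefore P j, add_lt_add_of_lt_of_le (c j).2 (countBefore_le_card P j)⟩)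
    (fun c hc => ?_) (fun c _ c' _ h => ?_) fun d hd => ?_
  · exact mem_filter.2 ⟨mem_univ _, fun i j hij => mem_weakAtWords_iff_strictMono.1 hc hij⟩
  · funext j
    exact Fin.ext (Nat.add_right_cancel (Fin.mk.inj_iff.1 (congrFun h j)))
  · have hd : StrictMono fun j => (d j : ℕ) := fun i j hij => (mem_filter.1 hd).2 hij
    have hmono := monotone_sub_countBefore P hd
    have hle j : countBefore P j ≤ d j := by
      have := hmono (Fin.zero_le j)
      simp only [countBefore_zero] at this
      omega
    have hlt j : d j - countBefore P j < m := by
      have := hle j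
      have := hmono (Fin.le_last j)
      simp only [countBefore_last] at this
      omega
    have hadd j : d j - countBefore P j + countBefore P j = d j := Nat.sub_add_cancel (hle j)
    refine ⟨fun j => ⟨d j - countBefore P j, hlt j⟩, mem_weakAtWords_iff_strictMono.2 ?_, ?_⟩
    · simpa only [hadd] using hd
    · simp only [hadd]

/-- The words `g` of length `N + 1` on `m` letters with `g_1 < g_2 > g_3 < ⋯`. Positions start
from `0`, so the ascents are at the even positions. -/
def upDownWords (m N : ℕ) : Finset (Fin (N + 1) → Fin m) :=
  {g | ∀ i : Fin N, (Even (i : ℕ) → g i.castSucc < g i.succ) ∧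
    (Odd (i : ℕ) → g i.succ < g i.castSucc)}

theorem mem_upDownWords {m N : ℕ} {g : Fin (N + 1) → Fin m} : g ∈ upDownWords m N ↔
    ∀ i : Fin N, (Even (i : ℕ) → g i.castSucc < g i.succ) ∧
      (Odd (i : ℕ) → g i.succ < g i.castSucc) := by
  simp [upDownWords]

theorem mem_alternatingPerms_iff_mem_upDownWords {N : ℕ} {w : Equiv.Perm (Fin (N + 1))} :
    w ∈ alternatingPerms (N + 1) ↔ ⇑w ∈ upDownWords (N + 1) N := by
  rw [alternatingPerms, mem_filter_univ, mem_upDownWords]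
  exact ⟨fun h i => h i.castSucc (by simp), fun h i hi => h ⟨i, by omega⟩⟩

theorem ne_of_mem_upDownWords {m N : ℕ} {g : Fin (N + 1) → Fin m} (hg : g ∈ upDownWords m N)
    (i : Fin N) : g i.castSucc ≠ g i.succ := by
  rcases Nat.even_or_odd (i : ℕ) with hi | hi
  · exact ((mem_upDownWords.1 hg i).1 hi).ne
  · exact ((mem_upDownWords.1 hg i).2 hi).ne'

/-- The key by which `standardization` sorts the positions of `g`: the letter first, and among equal
letters the later position first. -/
def sortKey {m n : ℕ} (g : Fin n → Fin m) (i : Fin n) : Fin m ×ₗ (Fin n)ᵒᵈ :=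
  toLex (g i, OrderDual.toDual i)

theorem sortKey_lt_sortKey {m n : ℕ} {g : Fin n → Fin m} {i j : Fin n} :
    sortKey g i < sortKey g j ↔ g i < g j ∨ g i = g j ∧ j < i := by
  simp [sortKey, Prod.Lex.toLex_lt_toLex]

theorem sortKey_injective {m n : ℕ} (g : Fin n → Fin m) : Function.Injective (sortKey g) :=
  fun _ _ h => (Prod.ext_iff.1 (toLex.injective h)).2

/-- The standardization of a word: the permutation that ranks the positions by their letters, equal
letters being ranked from right to left. -/
def standardization {m n : ℕ} (g : Fin n → Fin m) : Equiv.Perm (Fin n) :=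
  (Tuple.sort (sortKey g))⁻¹

theorem standardization_eq_iff {m n : ℕ} {g : Fin n → Fin m} {w : Equiv.Perm (Fin n)} :
    standardization g = w ↔ StrictMono (sortKey g ∘ ⇑w⁻¹) := by
  rw [standardization, inv_eq_iff_eq_inv, eq_comm, Tuple.eq_sort_iff]
  refine ⟨fun h => h.1.strictMono_of_injective ((sortKey_injective g).comp w⁻¹.injective),
    fun h => ⟨h.monotone, fun i j hij heq => ?_⟩⟩
  exact absurd heq (h hij).ne

theorem standardization_lt_standardization {m n : ℕ} {g : Fin n → Fin m} {i j : Fin n} :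
    standardization g i < standardization g j ↔ g i < g j ∨ g i = g j ∧ j < i := by
  have hmono := standardization_eq_iff.1 (rfl : standardization g = standardization g)
  rw [← hmono.lt_iff_lt, ← sortKey_lt_sortKey]
  simp

theorem standardization_mem_alternatingPerms {m N : ℕ} {g : Fin (N + 1) → Fin m}
    (hg : g ∈ upDownWords m N) : standardization g ∈ alternatingPerms (N + 1) := by
  rw [mem_alternatingPerms_iff_mem_upDownWords, mem_upDownWords]
  simp only [standardization_lt_standardization]
  exact fun i => (mem_upDownWords.1 hg i).imp (fun h hi => .inl (h hi)) fun h hi => .inl (h hi)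

/-- The positions of the big descents of `σ`. -/
def bigDescents {N : ℕ} (σ : Equiv.Perm (Fin (N + 1))) : Finset (Fin N) :=
  {i | (σ i.succ : ℕ) + 1 < σ i.castSucc}

theorem bigDes_eq_card_bigDescents {N : ℕ} (σ : Equiv.Perm (Fin (N + 1))) :
    bigDes σ = #(bigDescents σ) := by
  rw [bigDes, bigDescents, card_filter, card_filter, Fin.sum_univ_castSucc]
  simp [Fin.succ]

theorem lt_or_eq_of_mem_weakAtWords {m N : ℕ} {σ : Equiv.Perm (Fin (N + 1))}
    {c : Fin (N + 1) → Fin m} (hc : c ∈ weakAtWords m (bigDescents σ)) {a b : Fin (N + 1)}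
    (hab : a < b) : c a < c b ∨ c a = c b ∧ (σ b : ℕ) + 1 < σ a := by
  let r : Fin (N + 1) → Fin (N + 1) → Prop := fun a b =>
    c a < c b ∨ c a = c b ∧ (σ b : ℕ) + 1 < σ a
  have : IsTrans _ r := ⟨fun _ _ _ => by grind⟩
  refine (Fin.liftFun_iff_succ (f := id) r).2 (fun i => ?_) hab
  simpa [bigDescents] using mem_weakAtWords.1 hc i

theorem mem_upDownWords_and_standardization_eq_iff {m N : ℕ} {w : Equiv.Perm (Fin (N + 1))}
    (hw : w ∈ alternatingPerms (N + 1)) {g : Fin (N + 1) → Fin m} :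
    g ∈ upDownWords m N ∧ standardization g = w ↔ g ∘ ⇑w⁻¹ ∈ weakAtWords m (bigDescents w⁻¹) := by
  constructor
  · rintro ⟨hg, hw⟩
    refine mem_weakAtWords.2 fun i => ?_
    have hlt := standardization_eq_iff.1 hw i.castSucc_lt_succ
    refine (sortKey_lt_sortKey.1 hlt).imp_right fun ⟨heq, hdes⟩ => ⟨heq, ?_⟩
    rw [bigDescents, mem_filter_univ]
    refine lt_of_le_of_ne (Nat.succ_le_of_lt hdes) fun hadj => ?_
    have hj : (w⁻¹ i.succ : ℕ) < N := by omega
    have hsucc : Fin.succ ⟨_, hj⟩ = w⁻¹ i.castSucc := Fin.ext hadj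
    exact ne_of_mem_upDownWords hg ⟨_, hj⟩ (heq.symm.trans (congrArg g hsucc.symm))
  · intro hc
    rw [mem_alternatingPerms_iff_mem_upDownWords, mem_upDownWords] at hw
    refine ⟨mem_upDownWords.2 fun i => ⟨fun hi => ?_, fun hi => ?_⟩,
      standardization_eq_iff.2 fun a b hab => sortKey_lt_sortKey.2 ?_⟩
    · simpa [add_assoc] using lt_or_eq_of_mem_weakAtWords hc ((hw i).1 hi)
    · simpa using lt_or_eq_of_mem_weakAtWords hc ((hw i).2 hi)
    · exact (lt_or_eq_of_mem_weakAtWords hc hab).imp_right fun h => ⟨h.1, by omega⟩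

theorem card_upDownWords_standardization_eq (m : ℕ) {N : ℕ} {w : Equiv.Perm (Fin (N + 1))}
    (hw : w ∈ alternatingPerms (N + 1)) :
    #{g ∈ upDownWords m N | standardization g = w} = (m + bigDes w⁻¹).choose (N + 1) := by
  rw [bigDes_eq_card_bigDescents, ← card_weakAtWords]
  refine card_equiv (w.arrowCongr (Equiv.refl _)) fun g => ?_
  rw [mem_filter]
  exact mem_upDownWords_and_standardization_eq_iff hw

theorem sum_alternatingPerms_choose_bigDes (m N : ℕ) :
    ∑ w ∈ alternatingPerms (N + 1), (m + bigDes w⁻¹).choose (N + 1) = #(upDownWords m N) := by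
  rw [card_eq_sum_card_fiberwise fun g hg => standardization_mem_alternatingPerms hg]
  exact sum_congr rfl fun w hw => (card_upDownWords_standardization_eq m hw).symm

/-- Reverse the order of the letters at the odd positions. -/
def flipOdd {m n : ℕ} (g : Fin n → Fin m) (i : Fin n) : Fin m :=
  if Even (i : ℕ) then g i else (g i).rev

theorem flipOdd_involutive {m n : ℕ} : Function.Involutive (flipOdd (m := m) (n := n)) := by
  intro g
  funext i
  simp only [flipOdd]
  split_ifs <;> simp

theorem flipOdd_mem_zigzagWords {x k : ℕ} {g : Fin (k + 1) → Fin (x + 1)} :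
    flipOdd g ∈ zigzagWords x k ↔ g ∈ upDownWords (x + 1) k := by
  rw [mem_upDownWords, zigzagWords, mem_chainWords]
  refine forall_congr' fun i => ?_
  have h1 := (g i.castSucc).2
  have h2 := (g i.succ).2
  rcases Nat.even_or_odd (i : ℕ) with h | h
  · have h' : ¬ Odd (i : ℕ) := Nat.not_odd_iff_even.2 h
    simp only [flipOdd, Fin.val_castSucc, Fin.val_succ, h, Nat.even_add_one, h', not_true,
      if_true, if_false, true_imp_iff, false_imp_iff, and_true, Fin.lt_def, Fin.val_rev]
    omega
  · have h' : ¬ Even (i : ℕ) := Nat.not_even_iff_odd.2 h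
    simp only [flipOdd, Fin.val_castSucc, Fin.val_succ, h, Nat.even_add_one, h', not_false_iff,
      if_true, if_false, true_imp_iff, false_imp_iff, true_and, Fin.lt_def, Fin.val_rev]
    omega

theorem card_upDownWords (x k : ℕ) : #(upDownWords (x + 1) k) = #(zigzagWords x k) :=
  card_equiv flipOdd_involutive.toPerm fun _ => flipOdd_mem_zigzagWords.symm

/-! ### Comparison of the two polynomials -/

theorem exced_le {n : ℕ} (π : Fin n → ℕ) : exced π ≤ n :=
  (card_filter_le _ _).trans_eq (Fintype.card_fin n)

theorem bigDes_le {N : ℕ} (σ : Equiv.Perm (Fin (N + 1))) : bigDes σ ≤ N := by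
  rw [bigDes_eq_card_bigDescents]
  exact (card_filter_le _ _).trans_eq (Fintype.card_fin N)

theorem eval_neg_one_parkingEnumerator (n : ℕ) : (parkingEnumerator n).eval (-1 : ℤ[X]) =
    ∑ π ∈ parkingFunctions n, (-1 : ℤ) ^ cosum π • (X : ℤ[X]) ^ exced π := by
  simp [parkingEnumerator, eval_finsetSum, zsmul_eq_mul]

theorem natDegree_eval_neg_one_parkingEnumerator_le (n : ℕ) :
    ((parkingEnumerator n).eval (-1 : ℤ[X])).natDegree ≤ n := by
  rw [eval_neg_one_parkingEnumerator]
  exact natDegree_sum_le_of_forall_le _ _ fun π _ => (natDegree_smul_le _ _).trans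
    ((natDegree_X_pow_le _).trans (exced_le π))

theorem binomialFunctional_eval_neg_one_parkingEnumerator (n x : ℕ) :
    binomialFunctional ℤ n x ((parkingEnumerator n).eval (-1 : ℤ[X])) =
      (excessTransfer x)^[n] (Pi.single x 1) x := by
  simp only [eval_neg_one_parkingEnumerator, map_sum, map_smul, binomialFunctional_X_pow,
    smul_eq_mul, sum_parkingFunctions_choose]

theorem natDegree_sum_alternatingPerms_le (N : ℕ) :
    (∑ w ∈ alternatingPerms (N + 1), (X : ℤ[X]) ^ (bigDes w⁻¹ + 1)).natDegree ≤ N + 1 :=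
  natDegree_sum_le_of_forall_le _ _ fun w _ =>
    (natDegree_X_pow_le _).trans (Nat.succ_le_succ (bigDes_le w⁻¹))

theorem binomialFunctional_sum_alternatingPerms (k x : ℕ) :
    binomialFunctional ℤ (k + 2) x
        (∑ w ∈ alternatingPerms (k + 2), (X : ℤ[X]) ^ (bigDes w⁻¹ + 1)) =
      (excessTransfer x)^[k + 2] (Pi.single x 1) x := by
  have hshift (w : Equiv.Perm (Fin (k + 2))) :
      x + (bigDes w⁻¹ + 1) = x + 1 + bigDes w⁻¹ := by ring
  simp only [map_sum, binomialFunctional_X_pow, hshift]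
  rw [← Nat.cast_sum, sum_alternatingPerms_choose_bigDes, card_upDownWords, card_zigzagWords]

end

theorem theorem3p6 (n : ℕ) (hn : 2 ≤ n) :
    (parkingEnumerator n).eval (-1 : ℤ[X]) =
      ∑ w ∈ alternatingPerms n, (X : ℤ[X]) ^ (bigDes w⁻¹ + 1) := by
  obtain ⟨k, rfl⟩ : ∃ k, n = k + 2 := Nat.exists_eq_add_of_le' hn
  refine eq_of_forall_binomialFunctional_eq (natDegree_eval_neg_one_parkingEnumerator_le _)
    (natDegree_sum_alternatingPerms_le _) fun x => ?_
  rw [binomialFunctional_eval_neg_one_parkingEnumerator, binomialFunctional_sum_alternatingPerms]
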